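/- Let $\alpha>0$ and $w(x,t)=(1-x^2)^{\alpha}\mathrm e^{-t/x^2}$ for $x\in[-1,1]$, $t\ge 0$. For an integer $n\ge 0$ put $$D_n(t)=\det\left(\int_{-1}^{1}x^{j+k}w(x,t)\,dx\right)_{j,k=0}^{n-1}\qquad(D_0=1).$$ Let $P_n(\cdot,t)$ be the monic polynomial of degree $n$ in the sequence of orthogonal polynomials for the weight $w(\cdot,t)$ on $[-1,1]$, let $h_n(t)=\int_{-1}^{1}P_n(x,t)^2w(x,t)\,dx$, and put $$R_n(t)=\frac{2t}{h_n(t)}\int_{-1}^{1}\frac{P_n(y,t)^2w(y,t)}{y^2}\,dy .$$ **Theorem 4.4.** Let $n\ge 0$ be an integer. Then $D_n(s)>0$ for all $s\ge 0$, the function $R_n$ is positive and differentiable on $(0,\infty)$, and for every $t\ge 0$ \begin{align*} \ln\frac{D_n(t)}{D_n(0)}=\int_0^t\Big[&4s^2(2n+1+2\alpha)(R_n'(s))^2-4sR_n(s)\,(2n+1+2\alpha+R_n(s))\,R_n'(s)\\ &-(2n-1+2\alpha)R_n^4(s)-2\left(2n^2+4\alpha(n-s)-1\right)R_n^3(s)\\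 &-(2n+1+2\alpha)(4s^2-8\alpha s-1)R_n^2(s)-8s^2(2n+1+2\alpha)^2R_n(s)\\ &-4s^2(2n+1+2\alpha)^3\Big]\frac{ds}{8s\,R_n^2(s)\,(2n+1+2\alpha+R_n(s))}, \end{align*} where the integrand is Lebesgue integrable on $(0,t)$. -/

import Mathlib

noncomputable section

open MeasureTheory intervalIntegral Polynomial

namespace SingularJacobi

/-- The singularly perturbed Jacobi weight `w(x,t) = (1 - x²)^α exp(-t/x²)`, used for
`x ∈ [-1,1]`, `α > 0`, `t ≥ 0`. (For `t > 0` the value at the single point `x = 0` is irrelevant,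
since the weight is only ever integrated.) -/
def weight (α t x : ℝ) : ℝ := (1 - x ^ 2) ^ α * Real.exp (-(t / x ^ 2))

/-- The moment `μ_j(t) = ∫_{-1}^{1} x^j w(x,t) dx`. -/
def moment (α t : ℝ) (j : ℕ) : ℝ := ∫ x in (-1 : ℝ)..1, x ^ j * weight α t x

/-- The Hankel determinant `D_n(t) = det (μ_{j+k}(t))_{j,k=0}^{n-1}`. -/
def D (α : ℝ) (n : ℕ) (t : ℝ) : ℝ :=
  (Matrix.of fun j k : Fin n => moment α t ((j : ℕ) + (k : ℕ))).det

/-- The bilinear form `⟨p, q⟩_t = ∫_{-1}^{1} p(x) q(x) w(x,t) dx` on real polynomials. -/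
def ip (α t : ℝ) (p q : ℝ[X]) : ℝ :=
  ∫ x in (-1 : ℝ)..1, p.eval x * q.eval x * weight α t x

/-- The monic orthogonal polynomial `P_n(·,t)` with respect to `w(·,t)`, obtained from
`1, X, X², …` by the Gram–Schmidt process without normalization. -/
def P (α t : ℝ) (n : ℕ) : ℝ[X] :=
  X ^ n - ∑ k : Fin n, C (ip α t (X ^ n) (P α t k) / ip α t (P α t k) (P α t k)) * P α t k
termination_by n
decreasing_by all_goals exact k.2

/-- The squared norm `h_n(t) = ∫_{-1}^{1} P_n(x,t)² w(x,t) dx`. -/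
def h (α : ℝ) (n : ℕ) (t : ℝ) : ℝ := ip α t (P α t n) (P α t n)

/-- The auxiliary quantity
`R_n(t) = (2t / h_n(t)) ∫_{-1}^{1} P_n(y,t)² w(y,t) / y² dy`. -/
def R (α : ℝ) (n : ℕ) (t : ℝ) : ℝ :=
  2 * t / h α n t * ∫ y in (-1 : ℝ)..1, (P α t n).eval y ^ 2 * weight α t y / y ^ 2

/-- The rational expression in `s`, `R_n(s)`, `R_n'(s)` whose integral represents the logarithm of
the Hankel determinant. -/
def integrand (α : ℝ) (n : ℕ) (s : ℝ) : ℝ :=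
  (4 * s ^ 2 * (2 * n + 1 + 2 * α) * deriv (R α n) s ^ 2
    - 4 * s * R α n s * (2 * n + 1 + 2 * α + R α n s) * deriv (R α n) s
    - (2 * n - 1 + 2 * α) * R α n s ^ 4
    - 2 * (2 * n ^ 2 + 4 * α * (n - s) - 1) * R α n s ^ 3
    - (2 * n + 1 + 2 * α) * (4 * s ^ 2 - 8 * α * s - 1) * R α n s ^ 2
    - 8 * s ^ 2 * (2 * n + 1 + 2 * α) ^ 2 * R α n s
    - 4 * s ^ 2 * (2 * n + 1 + 2 * α) ^ 3)
  / (8 * s * R α n s ^ 2 * (2 * n + 1 + 2 * α + R α n s))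

/-! Sanity of the construction: for `α > 0` and `t ≥ 0`, the polynomials `P α t n` really are
monic of degree `n`, pairwise orthogonal, and have positive norms. -/

theorem P_natDegree_monic (α t : ℝ) (n : ℕ) : (P α t n).Monic ∧ (P α t n).natDegree = n := by
  induction n using Nat.strong_induction_on with
  | _ n ih =>
    have hdeg : (∑ k : Fin n, C (ip α t (X ^ n) (P α t k) / ip α t (P α t k) (P α t k))
        * P α t k).degree < (n : WithBot ℕ) := by
      refine (degree_sum_le _ _).trans_lt ((Finset.sup_lt_iff (WithBot.bot_lt_coe n)).2 ?_)
      intro k _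
      rw [← smul_eq_C_mul]
      refine (degree_smul_le _ _).trans_lt ?_
      rw [degree_eq_natDegree (ih k k.2).1.ne_zero, (ih k k.2).2]
      exact WithBot.coe_lt_coe.2 k.2
    have hm : (P α t n).Monic := by
      rw [P]; exact (monic_X_pow n).sub_of_left (by rwa [degree_X_pow])
    refine ⟨hm, ?_⟩
    apply natDegree_eq_of_degree_eq_some
    rw [P, degree_sub_eq_left_of_degree_lt (by rwa [degree_X_pow]), degree_X_pow]

theorem weight_nonneg (α t : ℝ) {x : ℝ} (hx : x ∈ Set.Icc (-1 : ℝ) 1) : 0 ≤ weight α t x :=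
  mul_nonneg (Real.rpow_nonneg (by nlinarith [hx.1, hx.2]) _) (Real.exp_pos _).le

theorem intervalIntegrable_mul_weight {α t : ℝ} (hα : 0 < α) (ht : 0 ≤ t) {f : ℝ → ℝ}
    (hf : Continuous f) :
    IntervalIntegrable (fun x => f x * weight α t x) volume (-1) 1 := by
  have hg : Continuous fun x : ℝ => f x * (1 - x ^ 2) ^ α :=
    hf.mul (Continuous.rpow_const (by fun_prop) fun _ => Or.inr hα.le)
  refine (hg.intervalIntegrable (-1) 1).mono_fun ?_ ?_
  · apply Measurable.aestronglyMeasurable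
    unfold weight
    have := hf.measurable
    fun_prop
  · refine Filter.Eventually.of_forall fun x => ?_
    simp only [weight, norm_mul]
    rw [← mul_assoc]
    refine mul_le_of_le_one_right (by positivity) ?_
    rw [Real.norm_eq_abs, abs_of_pos (Real.exp_pos _), Real.exp_le_one_iff]
    have : 0 ≤ t / x ^ 2 := by positivity
    linarith

theorem ip_self_pos {α t : ℝ} (hα : 0 < α) (ht : 0 ≤ t) {p : ℝ[X]} (hp : p ≠ 0) :
    0 < ip α t p p := by
  have hint := intervalIntegrable_mul_weight hα ht (f := fun x => p.eval x * p.eval x)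
    (by fun_prop)
  unfold ip
  rw [integral_pos_iff_support_of_nonneg_ae' ?_ hint]
  · refine ⟨by norm_num, ?_⟩
    have hsub : Set.Ioo (-1 : ℝ) 1 \ (p.roots.toFinset : Set ℝ) ⊆
        (Function.support fun x => p.eval x * p.eval x * weight α t x) ∩ Set.Ioc (-1) 1 := by
      rintro x ⟨hx, hr⟩
      have hpx : p.eval x ≠ 0 := by simpa [hp] using hr
      refine ⟨?_, hx.1, hx.2.le⟩
      have h1 : 0 < 1 - x ^ 2 := by nlinarith [hx.1, hx.2]
      have : 0 < weight α t x := mul_pos (Real.rpow_pos_of_pos h1 _) (Real.exp_pos _)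
      simp [hpx, this.ne']
    refine lt_of_lt_of_le ?_ (measure_mono hsub)
    rw [measure_sdiff_null (Set.Finite.measure_zero (Finset.finite_toSet _) _)]
    simp
  · rw [Filter.EventuallyLE, ae_restrict_iff' (by measurability)]
    refine Filter.Eventually.of_forall fun x hx => ?_
    rw [Set.uIoc_of_le (by norm_num)] at hx
    exact mul_nonneg (mul_self_nonneg _) (weight_nonneg α t ⟨hx.1.le, hx.2⟩)

theorem ip_P_of_lt {α t : ℝ} (hα : 0 < α) (ht : 0 ≤ t) {j n : ℕ} (hj : j < n) :
    ip α t (P α t n) (P α t j) = 0 := by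
  induction n using Nat.strong_induction_on generalizing j with
  | _ n ih =>
    have hi : ∀ p q : ℝ[X], IntervalIntegrable
        (fun x => p.eval x * q.eval x * weight α t x) volume (-1) 1 := fun p q =>
      intervalIntegrable_mul_weight hα ht (f := fun x => p.eval x * q.eval x) (by fun_prop)
    have hsub : ∀ p q r : ℝ[X], ip α t (p - q) r = ip α t p r - ip α t q r := by
      intro p q r
      unfold ip
      rw [← intervalIntegral.integral_sub (hi p r) (hi q r)]
      simp only [eval_sub, sub_mul]
    have hsum : ∀ (f : Fin n → ℝ[X]) (c : Fin n → ℝ) (r : ℝ[X]),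
        ip α t (∑ k, C (c k) * f k) r = ∑ k, c k * ip α t (f k) r := by
      intro f c r
      unfold ip
      simp only [← intervalIntegral.integral_const_mul]
      rw [← intervalIntegral.integral_finsetSum fun k _ => (hi (f k) r).const_mul (c k)]
      simp only [eval_finsetSum, eval_mul, eval_C, Finset.sum_mul, mul_assoc]
    have hcomm : ∀ p q : ℝ[X], ip α t p q = ip α t q p := by
      intro p q; unfold ip; simp only [mul_comm (p.eval _)]
    rw [P, hsub, hsum, Finset.sum_eq_single (⟨j, hj⟩ : Fin n)]
    · have := ip_self_pos hα ht (P_natDegree_monic α t j).1.ne_zero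
      field_simp
      simp
    · intro k _ hk
      have hne : (k : ℕ) ≠ j := fun e => hk (Fin.ext e)
      rcases lt_or_gt_of_ne hne with hlt | hlt
      · rw [hcomm (P α t k) (P α t j), ih j hj hlt, mul_zero]
      · rw [ih k k.2 hlt, mul_zero]
    · simp

end SingularJacobi

end

/-! Write `L_k(p) = ∫ p x^{-k} w`, let `β_n` be the recurrence coefficient in `x P_n = P_{n+1} + β_n
P_{n-1}`, and let `r_n` be `rho`. The recurrence and one integration by parts (`byParts`) give two
difference equations, `beta_mul_R_sub` and `rho_succ_sub_rho`. Multiplied by suitable factors these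
telescope: `beta_mul_R_mul_prev_R`, `rho_mul_rho_eq` and `sum_R_eq` express `β_n R_{n-1}`, `β_n
(2n-1+2α+R_{n-1})` and `∑_{k<n} R_k` through quantities of index `n`.

In `t`, integrals are differentiated only for `n = 0`, where `P_0 = 1` does not move. The difference
equations then propagate the derivatives of `h_n`, `β_n`, `r_n`, `R_n` by induction
(`derivFormulas`). In particular `R_n` satisfies a Riccati equation containing `r_n`, which is how
`R_n'` enters the formula.

Since `D_n = ∏ h_k` and `(ln h_k)' = -R_k/(2t)`, the logarithmic derivative of `D_n` is `-∑_{k<n}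
R_k/(2t)`, and the identities above turn this into the stated rational expression (`integrand_eq`).
As `R_k > 0`, the integrand has constant sign; with continuity of `D_n` up to `t = 0` this yields
integrability near `0` and the fundamental theorem of calculus on `[0,t]`. -/

noncomputable section

open MeasureTheory intervalIntegral Polynomial

namespace SingularJacobi

/-! ### Moments with negative powers -/

/-- The functional `p ↦ ∫_{-1}^{1} p(x) x^{-k} w(x,t) dx` on real polynomials. -/
def negMoment (α t : ℝ) (k : ℕ) (p : ℝ[X]) : ℝ :=
  ∫ x in (-1 : ℝ)..1, p.eval x * weight α t x / x ^ k

/-- Comes from `e^u ≥ u^k / k!` at `u = t/x²`. It makes every `L_k` converge for `t > 0`. -/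
theorem abs_exp_neg_div_sq_div_pow_le {t : ℝ} (ht : 0 < t) (k : ℕ) (x : ℝ) :
    |Real.exp (-(t / x ^ 2)) / x ^ k| ≤ k.factorial * |x| ^ k / t ^ k := by
  rcases eq_or_ne x 0 with rfl | hx
  · rcases Nat.eq_zero_or_pos k with rfl | hk
    · simp
    · simp [hk.ne']
  · have hx' : 0 < |x| := abs_pos.2 hx
    have h1 := Real.pow_div_factorial_le_exp (t / x ^ 2) (by positivity) k
    rw [abs_div, abs_of_pos (Real.exp_pos _), Real.exp_neg, abs_pow, ← sq_abs]
    rw [← sq_abs] at h1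
    have hk : (0 : ℝ) < k.factorial := by positivity
    have h2 : 0 < (t / |x| ^ 2) ^ k / k.factorial := by positivity
    refine (div_le_div_of_nonneg_right (inv_anti₀ h2 h1) (by positivity)).trans (le_of_eq ?_)
    rw [div_pow]
    field_simp
    ring

theorem weight_le_exp {α t x : ℝ} (hα : 0 < α) (hx : x ∈ Set.Icc (-1 : ℝ) 1) :
    weight α t x ≤ Real.exp (-(t / x ^ 2)) := by
  have : (1 - x ^ 2) ^ α ≤ 1 :=
    Real.rpow_le_one (by nlinarith [hx.1, hx.2]) (by nlinarith) hα.le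
  exact mul_le_of_le_one_left (Real.exp_pos _).le this

theorem abs_weight_div_pow_le {α t s x : ℝ} (hα : 0 < α) (ht : 0 < t) (hs : t ≤ s) (k : ℕ)
    (hx : x ∈ Set.Icc (-1 : ℝ) 1) : |weight α s x / x ^ k| ≤ k.factorial / t ^ k := by
  have h1 := abs_exp_neg_div_sq_div_pow_le (ht.trans_le hs) k x
  have hx1 : |x| ^ k ≤ 1 := pow_le_one₀ (abs_nonneg _) (abs_le.2 ⟨hx.1, hx.2⟩)
  calc |weight α s x / x ^ k| ≤ |Real.exp (-(s / x ^ 2)) / x ^ k| := by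
        rw [abs_div, abs_div, abs_of_nonneg (weight_nonneg α s hx), abs_of_pos (Real.exp_pos _)]
        exact div_le_div_of_nonneg_right (weight_le_exp hα hx) (abs_nonneg _)
    _ ≤ k.factorial * |x| ^ k / s ^ k := h1
    _ ≤ k.factorial * 1 / t ^ k := by
        have := ht.trans_le hs
        gcongr
    _ = _ := by rw [mul_one]

theorem measurable_weight (α t : ℝ) : Measurable (weight α t) := by
  unfold weight
  fun_prop

theorem intervalIntegrable_negMoment {α t : ℝ} (hα : 0 < α) (ht : 0 < t) (k : ℕ) (p : ℝ[X]) :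
    IntervalIntegrable (fun x => p.eval x * weight α t x / x ^ k) volume (-1) 1 := by
  have hg : Continuous fun x : ℝ => p.eval x * (k.factorial / t ^ k) := by fun_prop
  refine (hg.intervalIntegrable (-1) 1).mono_fun ?_ ?_
  · have := measurable_weight α t
    apply Measurable.aestronglyMeasurable
    have := p.continuous.measurable
    fun_prop
  · rw [Filter.EventuallyLE, ae_restrict_iff' (by measurability)]
    refine Filter.Eventually.of_forall fun x hx => ?_
    rw [Set.uIoc_of_le (by norm_num)] at hx
    rw [mul_div_assoc, norm_mul, norm_mul]
    refine mul_le_mul_of_nonneg_left ?_ (norm_nonneg _)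
    rw [Real.norm_eq_abs, Real.norm_eq_abs]
    exact (abs_weight_div_pow_le hα ht le_rfl k ⟨hx.1.le, hx.2⟩).trans (le_abs_self _)

theorem negMoment_add {α t : ℝ} (hα : 0 < α) (ht : 0 < t) (k : ℕ) (p q : ℝ[X]) :
    negMoment α t k (p + q) = negMoment α t k p + negMoment α t k q := by
  unfold negMoment
  rw [← intervalIntegral.integral_add (intervalIntegrable_negMoment hα ht k p)
    (intervalIntegrable_negMoment hα ht k q)]
  simp only [eval_add, add_mul, add_div]

theorem negMoment_smul (α t : ℝ) (k : ℕ) (c : ℝ) (p : ℝ[X]) :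
    negMoment α t k (c • p) = c * negMoment α t k p := by
  unfold negMoment
  rw [← intervalIntegral.integral_const_mul]
  simp only [eval_smul, smul_eq_mul, mul_assoc, mul_div_assoc]

theorem ae_ne_zero : ∀ᵐ x : ℝ ∂volume, x ≠ 0 := by
  simp [ae_iff, measure_singleton]

theorem negMoment_X_mul (α t : ℝ) (k : ℕ) (p : ℝ[X]) :
    negMoment α t (k + 1) (X * p) = negMoment α t k p := by
  unfold negMoment
  refine intervalIntegral.integral_congr_ae (ae_ne_zero.mono fun x hx _ => ?_)
  simp only [eval_mul, eval_X]
  field_simp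
  ring

theorem negMoment_zero_mul (α t : ℝ) (p q : ℝ[X]) : negMoment α t 0 (p * q) = ip α t p q := by
  simp [negMoment, ip]

/-- Holds because `x² ≤ 1` on the interval; it is the source of `R_n > 0`. -/
theorem ip_le_negMoment_two {α t : ℝ} (hα : 0 < α) (ht : 0 < t) (p : ℝ[X]) :
    ip α t p p ≤ negMoment α t 2 (p * p) := by
  rw [← negMoment_zero_mul]
  refine intervalIntegral.integral_mono_ae_restrict (by norm_num)
    (intervalIntegrable_negMoment hα ht 0 _) (intervalIntegrable_negMoment hα ht 2 _) ?_
  rw [Filter.EventuallyLE, ae_restrict_iff' (by measurability)]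
  refine ae_ne_zero.mono fun x hx hx1 => ?_
  have hw := weight_nonneg α t hx1
  have h2 : x ^ 2 ≤ 1 := by nlinarith [hx1.1, hx1.2]
  have h3 : 0 < x ^ 2 := by positivity
  rw [pow_zero, div_one, le_div_iff₀ h3, eval_mul]
  exact mul_le_of_le_one_right (mul_nonneg (mul_self_nonneg _) hw) h2

/-! ### Integration by parts -/

theorem hasDerivAt_byParts (α t : ℝ) (q : ℝ[X]) {x : ℝ} (hx : x ∈ Set.Ioo (-1 : ℝ) 1)
    (hx0 : x ≠ 0) :
    HasDerivAt (fun x => (1 - x ^ 2) ^ (α + 1) * q.eval x * (Real.exp (-(t / x ^ 2)) / x))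
      ((derivative q).eval x * weight α t x / x ^ 1
        - (X * derivative q).eval x * weight α t x / x ^ 0
        - (1 + 2 * α) * (q.eval x * weight α t x / x ^ 0)
        - q.eval x * weight α t x / x ^ 2
        + 2 * t * (q.eval x * weight α t x / x ^ 4)
        - 2 * t * (q.eval x * weight α t x / x ^ 2)) x := by
  have h1 : 0 < 1 - x ^ 2 := by nlinarith [hx.1, hx.2]
  have d1 : HasDerivAt (fun x : ℝ => 1 - x ^ 2) (-(2 * x)) x := by
    simpa using (hasDerivAt_pow 2 x).const_sub 1
  have d2 := d1.rpow_const (p := α + 1) (Or.inl h1.ne')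
  have d3 : HasDerivAt (fun x : ℝ => -(t / x ^ 2)) (2 * t / x ^ 3) x := by
    have := ((hasDerivAt_const x t).div (hasDerivAt_pow 2 x) (by positivity)).neg
    convert! this using 1
    field_simp
    simp [mul_comm]
  have d4 := (d2.mul (q.hasDerivAt x)).mul (d3.exp.div (hasDerivAt_id x) hx0)
  refine d4.congr_deriv ?_
  simp only [eval_mul, eval_X, weight, id, add_sub_cancel_right, Pi.mul_apply, Pi.div_apply]
  rw [Real.rpow_add_one h1.ne']
  field_simp
  ring

/-- Integrates the derivative of `(1 - x²) w q / x`. The factor `1 - x²` clears the pole of `w'/w`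
at `±1` and makes the boundary terms vanish. At the origin the exponential gives continuity, and the
fundamental theorem tolerates the single exceptional point `0`. -/
theorem byParts {α t : ℝ} (hα : 0 < α) (ht : 0 < t) (q : ℝ[X]) :
    negMoment α t 1 (derivative q) - negMoment α t 0 (X * derivative q)
      - (1 + 2 * α) * negMoment α t 0 q - negMoment α t 2 q + 2 * t * negMoment α t 4 q
      - 2 * t * negMoment α t 2 q = 0 := by
  have i := fun k p => intervalIntegrable_negMoment hα ht k p
  have hc : Continuous fun x : ℝ => Real.exp (-(t / x ^ 2)) / x := by
    rw [continuous_iff_continuousAt]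
    intro x
    rcases eq_or_ne x 0 with rfl | hx
    · have hb : ∀ x : ℝ, ‖Real.exp (-(t / x ^ 2)) / x‖ ≤ |x| / t := fun x => by
        simpa only [pow_one, Nat.factorial_one, Nat.cast_one, one_mul, Real.norm_eq_abs] using
          abs_exp_neg_div_sq_div_pow_le ht 1 x
      -- Division by zero assigns the value `0` at the origin, which is also the limit.
      rw [ContinuousAt, div_zero]
      refine squeeze_zero_norm hb ?_
      have : Continuous fun x : ℝ => |x| / t := by fun_prop
      simpa using this.tendsto 0
    · have : x ^ 2 ≠ 0 := by positivity
      fun_prop (disch := assumption)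
  have key := integral_eq_of_hasDerivAt_off_countable_of_le _ _ (by norm_num : (-1 : ℝ) ≤ 1)
    (Set.countable_singleton 0) (Continuous.continuousOn ?_)
    (fun x hx => hasDerivAt_byParts α t q hx.1 hx.2)
    ((((((i 1 _).sub (i 0 _)).sub ((i 0 q).const_mul (1 + 2 * α))).sub (i 2 q)).add
      ((i 4 q).const_mul (2 * t))).sub ((i 2 q).const_mul (2 * t)))
  · rw [intervalIntegral.integral_sub (((((i 1 _).sub (i 0 _)).sub
        ((i 0 q).const_mul (1 + 2 * α))).sub (i 2 q)).add ((i 4 q).const_mul (2 * t)))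
        ((i 2 q).const_mul (2 * t)),
      intervalIntegral.integral_add ((((i 1 _).sub (i 0 _)).sub
        ((i 0 q).const_mul (1 + 2 * α))).sub (i 2 q)) ((i 4 q).const_mul (2 * t)),
      intervalIntegral.integral_sub (((i 1 _).sub (i 0 _)).sub
        ((i 0 q).const_mul (1 + 2 * α))) (i 2 q),
      intervalIntegral.integral_sub ((i 1 _).sub (i 0 _)) ((i 0 q).const_mul (1 + 2 * α)),
      intervalIntegral.integral_sub (i 1 _) (i 0 _)] at key
    simp only [intervalIntegral.integral_const_mul] at key
    have hα1 : α + 1 ≠ 0 := by positivity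
    simpa [negMoment, Real.zero_rpow hα1] using key
  · refine Continuous.mul (Continuous.mul ?_ q.continuous) hc
    exact Continuous.rpow_const (by fun_prop) fun _ => Or.inr (by positivity)

/-! ### Dependence on the parameter -/

/-- Each `t`-derivative brings down `-x⁻²`; on `s > t/2` the resulting integrand has a uniform
bound. -/
theorem hasDerivAt_negMoment {α t : ℝ} (hα : 0 < α) (ht : 0 < t) (k : ℕ) (p : ℝ[X]) :
    HasDerivAt (fun s => negMoment α s k p) (-negMoment α t (k + 2) p) t := by
  have hm : ∀ (s : ℝ) (j : ℕ), Measurable fun x : ℝ => p.eval x * weight α s x / x ^ j := by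
    intro s j
    have := measurable_weight α s
    have := p.continuous.measurable
    fun_prop
  have hg : Continuous fun x : ℝ => ‖p.eval x‖ * ((k + 2).factorial / (t / 2) ^ (k + 2)) := by
    fun_prop
  have key := intervalIntegral.hasDerivAt_integral_of_dominated_loc_of_deriv_le
    (F := fun s x => p.eval x * weight α s x / x ^ k)
    (F' := fun s x => -(p.eval x * weight α s x / x ^ (k + 2)))
    (Ioi_mem_nhds (half_lt_self ht))
    (Filter.Eventually.of_forall fun s => (hm s k).aestronglyMeasurable)
    (intervalIntegrable_negMoment hα ht k p) (hm t (k + 2)).neg.aestronglyMeasurable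
    (Filter.Eventually.of_forall fun x hx s hs => ?_) (hg.intervalIntegrable (-1) 1)
    (ae_ne_zero.mono fun x hx _ s _ => ?_)
  · have := key.2
    rwa [intervalIntegral.integral_neg] at this
  · rw [Set.uIoc_of_le (by norm_num)] at hx
    rw [norm_neg, mul_div_assoc, norm_mul]
    exact mul_le_mul_of_nonneg_left (abs_weight_div_pow_le hα (half_pos ht) (le_of_lt hs) (k + 2)
      ⟨hx.1.le, hx.2⟩) (norm_nonneg _)
  · have d1 : HasDerivAt (fun s : ℝ => -(s / x ^ 2)) (-(1 / x ^ 2)) s :=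
      ((hasDerivAt_id s).div_const _).neg
    have d2 := (((d1.exp).const_mul ((1 - x ^ 2) ^ α)).const_mul (p.eval x)).div_const (x ^ k)
    refine d2.congr_deriv ?_
    simp only [weight]
    field_simp
    ring

/-- Includes `t = 0`, where the bounds on negative moments fail; here `w ≤ 1` supplies the
dominating function. -/
theorem continuousOn_moment {α : ℝ} (hα : 0 < α) (j : ℕ) :
    ContinuousOn (fun t => moment α t j) (Set.Ici 0) := by
  intro t _
  have hm : ∀ s : ℝ, Measurable fun x : ℝ => x ^ j * weight α s x := by
    intro s
    have := measurable_weight α s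
    fun_prop
  refine intervalIntegral.continuousWithinAt_of_dominated_interval (bound := fun _ => (1 : ℝ))
    (Filter.Eventually.of_forall fun s => (hm s).aestronglyMeasurable) ?_ (by simp)
    (Filter.Eventually.of_forall fun x _ => ?_)
  · filter_upwards [self_mem_nhdsWithin] with s hs
    refine Filter.Eventually.of_forall fun x hx => ?_
    rw [Set.uIoc_of_le (by norm_num)] at hx
    have hx' : x ∈ Set.Icc (-1 : ℝ) 1 := ⟨hx.1.le, hx.2⟩
    rw [norm_mul, Real.norm_eq_abs, Real.norm_eq_abs, abs_pow,
      abs_of_nonneg (weight_nonneg α s hx')]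
    refine mul_le_one₀ (pow_le_one₀ (abs_nonneg _) (abs_le.2 ⟨hx.1.le, hx.2⟩))
      (weight_nonneg α s hx') ((weight_le_exp hα hx').trans ?_)
    rw [Real.exp_le_one_iff, neg_nonpos]
    exact div_nonneg hs (sq_nonneg x)
  -- At `x = 0` the convention `t/0 = 0` makes the weight constant in `t`, so no case split is
  -- needed.
  · unfold weight
    fun_prop

theorem continuousOn_D {α : ℝ} (hα : 0 < α) (n : ℕ) : ContinuousOn (D α n) (Set.Ici 0) := by
  unfold D
  simp only [Matrix.det_apply]
  refine continuousOn_finsetSum _ fun σ _ => ContinuousOn.const_smul ?_ _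
  exact continuousOn_finsetProd _ fun i _ => continuousOn_moment hα _

/-! ### Orthogonality and the three-term recurrence -/

theorem ip_add_left {α t : ℝ} (hα : 0 < α) (ht : 0 ≤ t) (p q r : ℝ[X]) :
    ip α t (p + q) r = ip α t p r + ip α t q r := by
  unfold ip
  have hi : ∀ p : ℝ[X], IntervalIntegrable
      (fun x => p.eval x * r.eval x * weight α t x) volume (-1) 1 := fun p =>
    intervalIntegrable_mul_weight hα ht (f := fun x => p.eval x * r.eval x) (by fun_prop)
  rw [← intervalIntegral.integral_add (hi p) (hi q)]
  simp only [eval_add, add_mul]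

theorem ip_smul_left (α t c : ℝ) (p r : ℝ[X]) : ip α t (c • p) r = c * ip α t p r := by
  unfold ip
  rw [← intervalIntegral.integral_const_mul]
  simp only [eval_smul, smul_eq_mul, mul_assoc]

theorem ip_comm (α t : ℝ) (p q : ℝ[X]) : ip α t p q = ip α t q p := by
  unfold ip
  simp only [mul_comm (p.eval _)]

/-- The bilinear form `ip` as a bilinear map. -/
def ipₗ {α t : ℝ} (hα : 0 < α) (ht : 0 ≤ t) : ℝ[X] →ₗ[ℝ] ℝ[X] →ₗ[ℝ] ℝ :=
  LinearMap.mk₂ ℝ (ip α t) (ip_add_left hα ht) (ip_smul_left α t)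
    (fun p q r => by rw [ip_comm, ip_add_left hα ht, ip_comm, ip_comm α t r])
    (fun c p q => by rw [ip_comm, ip_smul_left, ip_comm, smul_eq_mul])

theorem ipₗ_apply {α t : ℝ} (hα : 0 < α) (ht : 0 ≤ t) (p q : ℝ[X]) :
    ipₗ hα ht p q = ip α t p q := rfl

theorem ip_P_of_degree_lt {α t : ℝ} (hα : 0 < α) (ht : 0 ≤ t) {n : ℕ} {q : ℝ[X]}
    (hq : q.degree < n) : ip α t (P α t n) q = 0 := by
  rw [← ipₗ_apply hα ht]
  induction hd : q.natDegree using Nat.strong_induction_on generalizing q with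
  | _ d ih =>
    rcases eq_or_ne q 0 with rfl | hq0
    · simp
    have hdn : d < n := by
      rw [degree_eq_natDegree hq0, hd] at hq
      exact_mod_cast hq
    obtain ⟨hm, hdeg⟩ := P_natDegree_monic α t d
    have hlt : (q - q.leadingCoeff • P α t d).degree < q.degree := by
      refine degree_sub_lt_left ?_ hq0 ?_
      · rw [degree_smul_of_smul_regular _ (IsSMulRegular.of_ne_zero (leadingCoeff_ne_zero.2 hq0)),
          degree_eq_natDegree hq0, degree_eq_natDegree hm.ne_zero, hd, hdeg]
      · rw [smul_eq_C_mul, leadingCoeff_mul, leadingCoeff_C, hm.leadingCoeff, mul_one]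
    have h0 : ipₗ hα ht (P α t n) (q - q.leadingCoeff • P α t d) = 0 := by
      rcases eq_or_ne (q - q.leadingCoeff • P α t d) 0 with h | h
      · rw [h, map_zero]
      · exact ih _ ((natDegree_lt_natDegree h hlt).trans_eq hd) (hlt.trans hq) rfl
    rwa [map_sub, map_smul, ipₗ_apply hα ht (P α t n) (P α t d), ip_P_of_lt hα ht hdn, smul_zero,
      sub_zero] at h0

theorem h_pos {α t : ℝ} (hα : 0 < α) (ht : 0 ≤ t) (n : ℕ) : 0 < h α n t :=
  ip_self_pos hα ht (P_natDegree_monic α t n).1.ne_zero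

theorem degree_P (α t : ℝ) (n : ℕ) : (P α t n).degree = n := by
  obtain ⟨hm, hd⟩ := P_natDegree_monic α t n
  rw [degree_eq_natDegree hm.ne_zero, hd]

theorem coeff_P_self (α t : ℝ) (n : ℕ) : (P α t n).coeff n = 1 := by
  obtain ⟨hm, hd⟩ := P_natDegree_monic α t n
  simpa [hd] using hm.coeff_natDegree

theorem ip_P_of_degree_le {α t : ℝ} (hα : 0 < α) (ht : 0 ≤ t) {n : ℕ} {q : ℝ[X]}
    (hq : q.degree ≤ n) : ip α t (P α t n) q = q.coeff n * h α n t := by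
  have hlt : (q - q.coeff n • P α t n).degree < n := by
    rw [degree_lt_iff_coeff_zero]
    intro m hm'
    rcases hm'.eq_or_lt with rfl | hm'
    · simp [coeff_P_self]
    · rw [coeff_sub, coeff_smul,
        coeff_eq_zero_of_degree_lt (hq.trans_lt (by exact_mod_cast hm')),
        coeff_eq_zero_of_degree_lt ((degree_P α t n).trans_lt (by exact_mod_cast hm'))]
      simp
  have h0 := ip_P_of_degree_lt hα ht hlt
  rw [← ipₗ_apply hα ht, map_sub, map_smul, ipₗ_apply, ipₗ_apply, sub_eq_zero] at h0
  rw [h0, smul_eq_mul, h]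

/-- Pairing a nonzero `q` of degree `d` with `P_d` gives its leading coefficient times `h_d`, which
is nonzero. -/
theorem eq_zero_of_ip_P {α t : ℝ} (hα : 0 < α) (ht : 0 ≤ t) {n : ℕ} {q : ℝ[X]}
    (hq : q.degree < n) (hq0 : ∀ k < n, ip α t q (P α t k) = 0) : q = 0 := by
  by_contra hne
  have hd : q.natDegree < n := by
    rw [degree_eq_natDegree hne] at hq
    exact_mod_cast hq
  have := hq0 _ hd
  rw [ip_comm, ip_P_of_degree_le hα ht degree_le_natDegree] at this
  exact mul_ne_zero (leadingCoeff_ne_zero.2 hne) (h_pos hα ht _).ne' this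

theorem degree_sub_P_lt {α t : ℝ} {n : ℕ} {q : ℝ[X]} (hm : q.Monic) (hd : q.natDegree = n) :
    (q - P α t n).degree < n := by
  obtain ⟨hPm, hPd⟩ := P_natDegree_monic α t n
  have hq : q.degree = n := by rw [degree_eq_natDegree hm.ne_zero, hd]
  rw [← hq]
  exact degree_sub_lt_left (by rw [hq, degree_P]) hm.ne_zero (by rw [hm.leadingCoeff, hPm.leadingCoeff])

theorem ip_comp_neg (α t : ℝ) (p q : ℝ[X]) :
    ip α t (p.comp (-X)) (q.comp (-X)) = ip α t p q := by
  unfold ip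
  have := intervalIntegral.integral_comp_neg (a := (-1 : ℝ)) (b := 1)
    (fun x => p.eval x * q.eval x * weight α t x)
  simp only [neg_neg] at this
  rw [← this]
  simp [weight]

/-- The weight is even, so `(-1)^n P_n(-x)` is also monic and orthogonal to all lower degrees;
uniqueness identifies it with `P_n`. -/
theorem P_comp_neg {α t : ℝ} (hα : 0 < α) (ht : 0 ≤ t) (n : ℕ) :
    (P α t n).comp (-X) = C ((-1) ^ n) * P α t n := by
  obtain ⟨hm, hd⟩ := P_natDegree_monic α t n
  have hnd : ((P α t n).comp (-X)).natDegree = n := by rw [natDegree_comp]; simp [hd]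
  have hlc : ((P α t n).comp (-X)).leadingCoeff = (-1) ^ n := by
    rw [leadingCoeff_comp (by simp)]
    simp [hm.leadingCoeff, hd]
  set q := C ((-1) ^ n) * (P α t n).comp (-X) with hq
  have hu : ((-1 : ℝ) ^ n) * (-1) ^ n = 1 := by rw [← mul_pow]; simp
  have hqm : q.Monic := by
    rw [Monic, hq, leadingCoeff_mul, leadingCoeff_C, hlc, hu]
  have hqd : q.natDegree = n := by
    rw [hq, natDegree_C_mul (pow_ne_zero _ (by norm_num)), hnd]
  have h0 : q - P α t n = 0 := by
    refine eq_zero_of_ip_P hα ht (degree_sub_P_lt hqm hqd) fun k hk => ?_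
    have hdeg : ((P α t k).comp (-X)).degree < n := by
      refine degree_le_natDegree.trans_lt ?_
      rw [natDegree_comp, (P_natDegree_monic α t k).2]
      simpa using hk
    have h1 : ip α t q (P α t k) = 0 := by
      have := ip_comp_neg α t (P α t n) ((P α t k).comp (-X))
      rw [comp_assoc] at this
      simp only [neg_comp, X_comp, neg_neg, comp_X] at this
      rw [hq, ← smul_eq_C_mul, ip_smul_left, this, ip_P_of_degree_lt hα ht hdeg, mul_zero]
    rw [← ipₗ_apply hα ht, map_sub, LinearMap.sub_apply, ipₗ_apply, ipₗ_apply, h1,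
      ip_P_of_lt hα ht hk, sub_zero]
  rw [sub_eq_zero] at h0
  conv_rhs => rw [← h0, hq, ← mul_assoc, ← C_mul, hu, C_1, one_mul]

theorem ip_X_mul_P_self {α t : ℝ} (hα : 0 < α) (ht : 0 ≤ t) (n : ℕ) :
    ip α t (X * P α t n) (P α t n) = 0 := by
  have := ip_comp_neg α t (X * P α t n) (P α t n)
  rw [mul_comp, X_comp, P_comp_neg hα ht, ← smul_eq_C_mul, ← ipₗ_apply hα ht, map_smul,
    show -X * (((-1 : ℝ) ^ n) • P α t n) = (-(-1 : ℝ) ^ n) • (X * P α t n) by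
      rw [mul_smul_comm, neg_mul, smul_neg, neg_smul],
    map_smul, LinearMap.smul_apply, smul_smul, ipₗ_apply, smul_eq_mul] at this
  have hu : ((-1 : ℝ) ^ n) * (-1) ^ n = 1 := by rw [← mul_pow]; simp
  rw [mul_neg, hu] at this
  linarith

/-- Shift of a sequence by one, with value `0` at the start: `prev f n = f (n - 1)`. -/
def prev {M : Type*} [Zero M] (f : ℕ → M) : ℕ → M
  | 0 => 0
  | n + 1 => f n

theorem prev_succ {M : Type*} [Zero M] (f : ℕ → M) (n : ℕ) : prev f (n + 1) = f n := rfl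

/-- The recurrence coefficient `β_n = h_n / h_{n-1}`, with `β_0 = 0`. -/
def beta (α : ℝ) (n : ℕ) (t : ℝ) : ℝ := h α n t / prev (fun k => h α k t) n

theorem beta_zero (α t : ℝ) : beta α 0 t = 0 := by simp [beta, prev]

theorem beta_succ (α t : ℝ) (n : ℕ) : beta α (n + 1) t = h α (n + 1) t / h α n t := rfl

/-- Parity removes the diagonal term of the three-term recurrence; the remaining coefficients are
checked by pairing the difference with each `P_k`, `k ≤ n`. -/
theorem X_mul_P {α t : ℝ} (hα : 0 < α) (ht : 0 ≤ t) (n : ℕ) :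
    X * P α t n = P α t (n + 1) + beta α n t • prev (P α t) n := by
  obtain ⟨hm, hd⟩ := P_natDegree_monic α t n
  have hXm : (X * P α t n).Monic := monic_X.mul hm
  have hXd : (X * P α t n).natDegree = n + 1 := by
    rw [natDegree_X_mul hm.ne_zero, hd]
  have hprev : (prev (P α t) n).degree < (n + 1 : ℕ) := by
    cases n with
    | zero => simp [prev]
    | succ n => rw [prev, degree_P]; exact_mod_cast by omega
  have hsm : (beta α n t • prev (P α t) n).degree < (n + 1 : ℕ) :=
    (degree_smul_le _ _).trans_lt hprev
  rw [← sub_eq_zero, ← sub_sub]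
  refine eq_zero_of_ip_P hα ht (n := n + 1) ((degree_sub_le _ _).trans_lt
    (max_lt (degree_sub_P_lt hXm hXd) hsm)) fun k hk => ?_
  rw [← ipₗ_apply hα ht, map_sub, map_sub, LinearMap.sub_apply, LinearMap.sub_apply, map_smul,
    LinearMap.smul_apply, ipₗ_apply, ipₗ_apply, ipₗ_apply, ip_P_of_lt hα ht hk, sub_zero,
    smul_eq_mul]
  have hswap : ip α t (X * P α t n) (P α t k) = ip α t (P α t n) (X * P α t k) := by
    refine intervalIntegral.integral_congr fun x _ => ?_
    simp only [eval_mul]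
    ring
  rcases (Nat.lt_succ_iff.1 hk).eq_or_lt with rfl | hk
  · rw [ip_X_mul_P_self hα ht]
    cases k with
    | zero => simp [beta_zero]
    | succ k => rw [prev, ip_comm, ip_P_of_lt hα ht (Nat.lt_succ_self k), mul_zero, sub_zero]
  · obtain ⟨m, rfl⟩ : ∃ m, n = m + 1 := ⟨n - 1, by omega⟩
    rw [hswap, prev]
    rcases (Nat.lt_succ_iff.1 hk).eq_or_lt with rfl | hk
    · have hco : (X * P α t k).coeff (k + 1) = 1 := by
        rw [coeff_X_mul, coeff_P_self]
      rw [ip_P_of_degree_le hα ht, hco, one_mul, beta_succ]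
      · change _ - _ / _ * h α k t = 0
        rw [div_mul_cancel₀ _ (h_pos hα ht k).ne', sub_self]
      · rw [degree_mul, degree_X, degree_P, add_comm]; norm_cast
    · rw [ip_P_of_lt hα ht hk, ip_P_of_degree_lt hα ht, mul_zero, sub_zero]
      rw [degree_mul, degree_X, degree_P, add_comm]
      exact_mod_cast by omega

/-- The coefficient matrix of `P_0, …, P_{n-1}` has determinant `1` and, by orthogonality,
conjugates the Hankel matrix to `diag(h_k)`. -/
theorem D_eq_prod_h {α t : ℝ} (hα : 0 < α) (ht : 0 ≤ t) (n : ℕ) :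
    D α n t = ∏ k ∈ Finset.range n, h α k t := by
  set A : Matrix (Fin n) (Fin n) ℝ := Matrix.of fun i j => (P α t j).coeff i with hA
  set H : Matrix (Fin n) (Fin n) ℝ := Matrix.of fun j k : Fin n => moment α t ((j : ℕ) + (k : ℕ))
    with hH
  have hdetA : A.det = 1 := Matrix.det_matrixOfPolynomials _
    (fun i => (P_natDegree_monic α t i).2) (fun i => (P_natDegree_monic α t i).1)
  have hP : ∀ j : Fin n, P α t j = ∑ i : Fin n, (P α t j).coeff i • (X ^ (i : ℕ) : ℝ[X]) := by
    intro j
    rw [Fin.sum_univ_eq_sum_range fun i => (P α t j).coeff i • (X ^ i : ℝ[X])]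
    conv_lhs => rw [as_sum_range' (P α t j) n ((P_natDegree_monic α t j).2.trans_lt j.2)]
    simp only [smul_X_eq_monomial]
  have hmul : A.transpose * H * A = Matrix.diagonal fun k : Fin n => h α k t := by
    ext i j
    have h1 : (A.transpose * H * A) i j = ip α t (P α t i) (P α t j) := by
      rw [hP i, hP j, ← ipₗ_apply hα ht]
      simp only [map_sum, map_smul, LinearMap.sum_apply, LinearMap.smul_apply, ipₗ_apply,
        smul_eq_mul, Matrix.mul_apply, Matrix.transpose_apply, hA, hH, Matrix.of_apply]
      refine Finset.sum_congr rfl fun k _ => ?_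
      rw [mul_comm]
      congr 1
      refine Finset.sum_congr rfl fun l _ => ?_
      congr 1
      simp [ip, moment, pow_add]
    rw [h1, Matrix.diagonal_apply]
    split_ifs with hij
    · rw [hij, h]
    · rcases lt_or_gt_of_ne hij with hlt | hlt
      · rw [ip_comm, ip_P_of_lt hα ht hlt]
      · rw [ip_P_of_lt hα ht hlt]
  have := congrArg Matrix.det hmul
  rw [Matrix.det_mul, Matrix.det_mul, Matrix.det_transpose, hdetA, Matrix.det_diagonal, one_mul,
    mul_one, Fin.prod_univ_eq_prod_range (fun k => h α k t)] at this
  exact this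

/-! ### Difference equations for `R_n` and the auxiliary quantity `r_n` -/

/-- The auxiliary quantity `r_n`, given by `r_0 = 0` and `r_{n+1} + r_n = R_n`; it equals
`(2t / h_{n-1}) ∫ P_n P_{n-1} w / y³` for `n ≥ 1`. -/
def rho (α : ℝ) : ℕ → ℝ → ℝ
  | 0 => 0
  | n + 1 => fun t => R α n t - rho α n t

theorem rho_succ (α t : ℝ) (n : ℕ) : rho α (n + 1) t = R α n t - rho α n t := rfl

theorem beta_mul_prev_h {α t : ℝ} (hα : 0 < α) (ht : 0 ≤ t) (n : ℕ) :
    beta α n t * (beta α n t * prev (fun k => h α k t) n) = beta α n t * h α n t := by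
  cases n with
  | zero => simp [beta_zero]
  | succ n =>
    rw [beta_succ]
    have := (h_pos hα ht n).ne'
    simp only [prev_succ]
    field_simp

theorem negMoment_two_P_mul_self {α t : ℝ} (hα : 0 < α) (ht : 0 < t) (n : ℕ) :
    2 * t * negMoment α t 2 (P α t n * P α t n) = h α n t * R α n t := by
  have := (h_pos hα ht.le n).ne'
  simp only [R, negMoment, ← sq, eval_pow]
  field_simp

theorem R_pos {α t : ℝ} (hα : 0 < α) (ht : 0 < t) (n : ℕ) : 0 < R α n t := by
  have h1 := negMoment_two_P_mul_self hα ht n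
  have h2 := ip_le_negMoment_two hα ht (P α t n)
  have h3 : 0 < h α n t := h_pos hα ht.le n
  have h4 : 0 < h α n t * R α n t := by
    rw [← h1]
    exact mul_pos (by positivity) (h3.trans_le h2)
  exact (pos_iff_pos_of_mul_pos h4).1 h3

/-- Applying `L_1` to `x P_n²` shows that consecutive values, divided by `h_n`, sum to `1`; starting
from `0` they alternate `0, 1`. This is where `(-1)^n` enters. -/
theorem negMoment_one_P_mul_prev {α t : ℝ} (hα : 0 < α) (ht : 0 < t) (n : ℕ) :
    beta α n t * negMoment α t 1 (P α t n * prev (P α t) n) =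
      h α n t * ((1 - (-1) ^ n) / 2) := by
  induction n with
  | zero => simp [beta_zero]
  | succ n ih =>
    have e : X * (P α t n * P α t n) =
        P α t (n + 1) * P α t n + beta α n t • (P α t n * prev (P α t) n) := by
      rw [← mul_assoc, X_mul_P hα ht.le, add_mul, smul_mul_assoc, mul_comm (prev _ _)]
    have h1 := negMoment_X_mul α t 0 (P α t n * P α t n)
    rw [e, negMoment_add hα ht, negMoment_smul, zero_add, ih, negMoment_zero_mul] at h1
    have hn := (h_pos hα ht.le n).ne'
    change _ = h α n t at h1
    simp only [prev_succ]
    rw [beta_succ, pow_succ, eq_sub_of_add_eq h1]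
    field_simp
    ring

/-- Identifies the recursively defined `r_n` with an integral: `L_3` of `x P_n²` reproduces `r_{n+1}
+ r_n = R_n`. -/
theorem negMoment_three_P_mul_prev {α t : ℝ} (hα : 0 < α) (ht : 0 < t) (n : ℕ) :
    2 * t * (beta α n t * negMoment α t 3 (P α t n * prev (P α t) n)) =
      h α n t * rho α n t := by
  induction n with
  | zero => simp [beta_zero, rho]
  | succ n ih =>
    have e : X * (P α t n * P α t n) =
        P α t (n + 1) * P α t n + beta α n t • (P α t n * prev (P α t) n) := by
      rw [← mul_assoc, X_mul_P hα ht.le, add_mul, smul_mul_assoc, mul_comm (prev _ _)]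
    have h1 := negMoment_X_mul α t 2 (P α t n * P α t n)
    rw [e, negMoment_add hα ht, negMoment_smul] at h1
    have h2 := negMoment_two_P_mul_self hα ht n
    have hn := (h_pos hα ht.le n).ne'
    simp only [prev_succ]
    rw [beta_succ, rho_succ]
    have h3 : 2 * t * negMoment α t 3 (P α t (n + 1) * P α t n) =
        h α n t * (R α n t - rho α n t) := by
      linear_combination 2 * t * h1 - ih + h2
    field_simp
    linear_combination h α (n + 1) t * h3

/-- Factor the difference of squares; `P_{n+1} + β_n P_{n-1}` is `x P_n`. The factor `x` lowers the
order of a negative moment by one. -/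
theorem sq_sub_sq_eq {α t : ℝ} (hα : 0 < α) (ht : 0 ≤ t) (n : ℕ) :
    P α t (n + 1) * P α t (n + 1) -
        (beta α n t * beta α n t) • (prev (P α t) n * prev (P α t) n) =
      X * (P α t (n + 1) * P α t n - beta α n t • (P α t n * prev (P α t) n)) := by
  have := X_mul_P hα ht n
  have e : X * (P α t (n + 1) * P α t n - beta α n t • (P α t n * prev (P α t) n)) =
      X * P α t n * (P α t (n + 1) - beta α n t • prev (P α t) n) := by
    simp only [smul_eq_C_mul]
    ring
  rw [e, this]
  simp only [smul_eq_C_mul, C_mul]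
  ring

theorem negMoment_two_prev_mul_self {α t : ℝ} (hα : 0 < α) (ht : 0 < t) (n : ℕ) :
    2 * t * ((beta α n t * beta α n t) * negMoment α t 2 (prev (P α t) n * prev (P α t) n)) =
      h α n t * (beta α n t * prev (fun k => R α k t) n) := by
  cases n with
  | zero => simp [beta_zero]
  | succ n =>
    have h1 := negMoment_two_P_mul_self hα ht n
    have h2 := beta_mul_prev_h hα ht.le (n + 1)
    simp only [prev_succ] at h2 ⊢
    linear_combination (beta α (n + 1) t * beta α (n + 1) t) * h1 + R α n t * h2

/-- Evaluates `L_2` of the difference of squares in two ways: termwise, and through its factor `x`.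
-/
theorem beta_mul_R_sub {α t : ℝ} (hα : 0 < α) (ht : 0 < t) (n : ℕ) :
    beta α (n + 1) t * R α (n + 1) t - beta α n t * prev (fun k => R α k t) n =
      2 * t * (-1) ^ n := by
  have h1 := negMoment_X_mul α t 1
    (P α t (n + 1) * P α t n - beta α n t • (P α t n * prev (P α t) n))
  rw [← sq_sub_sq_eq hα ht.le n, sub_eq_add_neg, ← neg_smul, negMoment_add hα ht, negMoment_smul,
    sub_eq_add_neg, ← neg_smul, negMoment_add hα ht, negMoment_smul] at h1
  have h2 := negMoment_two_P_mul_self hα ht (n + 1)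
  have h3 := negMoment_two_prev_mul_self hα ht n
  have h4 := negMoment_one_P_mul_prev hα ht n
  have h5 := negMoment_one_P_mul_prev hα ht (n + 1)
  have hn := (h_pos hα ht.le n).ne'
  have hn1 := (h_pos hα ht.le (n + 1)).ne'
  have h6 : negMoment α t 1 (P α t (n + 1) * P α t n) = h α n t * ((1 + (-1) ^ n) / 2) := by
    simp only [prev_succ] at h5
    rw [beta_succ, pow_succ] at h5
    field_simp at h5
    linear_combination h5 / 2
  have hb : beta α (n + 1) t * h α n t = h α (n + 1) t := by
    rw [beta_succ, div_mul_cancel₀ _ hn]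
  apply mul_left_cancel₀ hn
  linear_combination R α (n + 1) t * hb + 2 * t * h1 + 2 * t * h6 - 2 * t * h4 - h2 + h3

theorem ip_P_X_mul_derivative {α t : ℝ} (hα : 0 < α) (ht : 0 ≤ t) (n : ℕ) :
    ip α t (P α t n) (X * derivative (P α t n)) = n * h α n t := by
  obtain ⟨hm, hd⟩ := P_natDegree_monic α t n
  have hco : (X * derivative (P α t n)).coeff n = (n : ℝ) := by
    cases n with
    | zero => simp
    | succ n =>
      rw [coeff_X_mul, coeff_derivative, coeff_P_self]
      simp
  have hdeg : (X * derivative (P α t n)).degree ≤ (n : WithBot ℕ) := by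
    rw [degree_le_iff_coeff_zero]
    intro m hm'
    have hm' : n < m := by exact_mod_cast hm'
    obtain ⟨k, rfl⟩ : ∃ k, m = k + 1 := ⟨m - 1, by omega⟩
    rw [coeff_X_mul, coeff_derivative, coeff_eq_zero_of_natDegree_lt (by omega), zero_mul]
  rw [ip_P_of_degree_le hα ht hdeg, hco]

theorem degree_derivative_P_lt (α t : ℝ) (n : ℕ) : (derivative (P α t n)).degree < n := by
  have := degree_derivative_lt (P_natDegree_monic α t n).1.ne_zero
  rwa [degree_P] at this

theorem negMoment_zero_derivative_P_mul_P {α t : ℝ} (hα : 0 < α) (ht : 0 < t) (n : ℕ) :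
    negMoment α t 0 (derivative (P α t (n + 1) * P α t n)) = (n + 1) * h α n t := by
  obtain ⟨hm, hd⟩ := P_natDegree_monic α t (n + 1)
  have hdeg : (derivative (P α t (n + 1))).degree ≤ n :=
    degree_le_of_natDegree_le (by
      have := natDegree_derivative_le (P α t (n + 1))
      omega)
  have hco : (derivative (P α t (n + 1))).coeff n = n + 1 := by
    rw [coeff_derivative, coeff_P_self, one_mul]
  rw [derivative_mul, negMoment_add hα ht, negMoment_zero_mul, negMoment_zero_mul, ip_comm,
    ip_P_of_degree_le hα ht.le hdeg, hco, ip_P_of_degree_lt hα ht.le, add_zero]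
  exact (degree_derivative_P_lt α t n).trans (by exact_mod_cast n.lt_succ_self)

theorem beta_mul_negMoment_zero_derivative {α t : ℝ} (hα : 0 < α) (ht : 0 < t) (n : ℕ) :
    beta α n t * negMoment α t 0 (derivative (P α t n * prev (P α t) n)) = n * h α n t := by
  cases n with
  | zero => simp [beta_zero]
  | succ n =>
    have hn := (h_pos hα ht.le n).ne'
    simp only [prev_succ]
    rw [negMoment_zero_derivative_P_mul_P hα ht n, beta_succ]
    push_cast
    field_simp

/-- Integration by parts with `q = P_{n+1}² - β_n² P_{n-1}² = x s`. Through `s` the unknown `L_4(q)`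
becomes `L_3(s)`, which `r_{n+1} - r_n` measures; the regular terms follow from orthogonality. -/
theorem rho_succ_sub_rho {α t : ℝ} (hα : 0 < α) (ht : 0 < t) (n : ℕ) :
    1 + rho α (n + 1) t - rho α n t =
      beta α (n + 1) t * (2 * n + 3 + 2 * α + R α (n + 1) t) -
      beta α n t * (2 * n - 1 + 2 * α + prev (fun k => R α k t) n) := by
  set s : ℝ[X] := P α t (n + 1) * P α t n - beta α n t • (P α t n * prev (P α t) n) with hs
  set q : ℝ[X] := P α t (n + 1) * P α t (n + 1) -
        (beta α n t * beta α n t) • (prev (P α t) n * prev (P α t) n) with hq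
  have hqs : q = X * s := sq_sub_sq_eq hα ht.le n
  have hlin : ∀ k, negMoment α t k s = negMoment α t k (P α t (n + 1) * P α t n) -
      beta α n t * negMoment α t k (P α t n * prev (P α t) n) := fun k => by
    rw [hs, sub_eq_add_neg, ← neg_smul, negMoment_add hα ht, negMoment_smul]
    ring
  have hlinq : ∀ k, negMoment α t k q = negMoment α t k (P α t (n + 1) * P α t (n + 1)) -
      beta α n t * beta α n t * negMoment α t k (prev (P α t) n * prev (P α t) n) := fun k => by
    rw [hq, sub_eq_add_neg, ← neg_smul, negMoment_add hα ht, negMoment_smul]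
    ring
  have hn := (h_pos hα ht.le n).ne'
  have hb : beta α (n + 1) t * h α n t = h α (n + 1) t := by
    rw [beta_succ, div_mul_cancel₀ _ hn]
  have hbp := byParts hα ht q
  -- singular part, through `q = X * s`
  have e1 : negMoment α t 1 (derivative q) =
      negMoment α t 1 s + negMoment α t 0 (derivative s) := by
    rw [hqs, derivative_mul, derivative_X, one_mul, negMoment_add hα ht, negMoment_X_mul]
  have e2 : negMoment α t 2 q = negMoment α t 1 s := by rw [hqs, negMoment_X_mul]
  have e4 : negMoment α t 4 q = negMoment α t 3 s := by rw [hqs, negMoment_X_mul]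
  have e0 : negMoment α t 0 (derivative s) = h α n t := by
    rw [hs, derivative_sub, derivative_smul, sub_eq_add_neg, ← neg_smul, negMoment_add hα ht,
      negMoment_smul, negMoment_zero_derivative_P_mul_P hα ht n]
    linear_combination -(beta_mul_negMoment_zero_derivative hα ht n)
  have e3 : 2 * t * negMoment α t 3 s = h α n t * (rho α (n + 1) t - rho α n t) := by
    have h1 := negMoment_three_P_mul_prev hα ht (n + 1)
    have h2 := negMoment_three_P_mul_prev hα ht n
    simp only [prev_succ] at h1
    have hn1 := (h_pos hα ht.le (n + 1)).ne'
    have h3 : 2 * t * negMoment α t 3 (P α t (n + 1) * P α t n) =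
        h α n t * rho α (n + 1) t := by
      apply mul_left_cancel₀ hn1
      rw [← hb] at h1 ⊢
      linear_combination h α n t * h1
    rw [hlin]
    linear_combination h3 - h2
  -- regular part
  have hsq : ∀ p : ℝ[X], negMoment α t 0 (X * derivative (p * p)) =
      2 * ip α t p (X * derivative p) := by
    intro p
    rw [← negMoment_zero_mul, ← negMoment_smul, derivative_mul]
    congr 1
    rw [two_smul]
    ring
  have f0 : negMoment α t 0 (P α t (n + 1) * P α t (n + 1)) = h α (n + 1) t :=
    negMoment_zero_mul _ _ _ _
  have f0' : beta α n t * beta α n t * negMoment α t 0 (prev (P α t) n * prev (P α t) n) =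
      beta α n t * h α n t := by
    rw [← beta_mul_prev_h hα ht.le, negMoment_zero_mul, mul_assoc]
    cases n with
    | zero => simp [beta_zero]
    | succ n => rfl
  have f1 : negMoment α t 0 (X * derivative q) =
      2 * (n + 1) * h α (n + 1) t - 2 * (n - 1) * (beta α n t * h α n t) := by
    have g : beta α n t * beta α n t *
        ip α t (prev (P α t) n) (X * derivative (prev (P α t) n)) =
        (n - 1) * (beta α n t * h α n t) := by
      rw [← beta_mul_prev_h hα ht.le]
      cases n with
      | zero => simp [beta_zero]
      | succ n =>
        simp only [prev_succ]
        rw [ip_P_X_mul_derivative hα ht.le n]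
        push_cast
        ring
    rw [hq, derivative_sub, derivative_smul, mul_sub, mul_smul_comm, sub_eq_add_neg, ← neg_smul,
      negMoment_add hα ht, negMoment_smul, hsq, hsq, ip_P_X_mul_derivative hα ht.le (n + 1)]
    push_cast
    linear_combination -2 * g
  have f2 : 2 * t * negMoment α t 2 q =
      h α (n + 1) t * R α (n + 1) t - h α n t * (beta α n t * prev (fun k => R α k t) n) := by
    rw [hlinq, ← negMoment_two_P_mul_self hα ht, ← negMoment_two_prev_mul_self hα ht]
    ring
  have f3 : negMoment α t 0 q = h α (n + 1) t - beta α n t * h α n t := by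
    rw [hlinq, f0, f0']
  apply mul_left_cancel₀ hn
  rw [f2, f3, f1, e4, e3, e1, e0, e2] at hbp
  linear_combination hbp - (2 * n + 3 + 2 * α + R α (n + 1) t) * hb

/-! ### Summed difference equations -/

/-- `beta_mul_R_sub` times `R_n = r_{n+1} + r_n` telescopes. -/
theorem beta_mul_R_mul_prev_R {α t : ℝ} (hα : 0 < α) (ht : 0 < t) (n : ℕ) :
    beta α n t * R α n t * prev (fun k => R α k t) n = -2 * (-1) ^ n * t * rho α n t := by
  induction n with
  | zero => simp [beta_zero, rho]
  | succ n ih =>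
    have hB := beta_mul_R_sub hα ht n
    simp only [prev_succ]
    rw [rho_succ, pow_succ]
    linear_combination R α n t * hB + ih

/-- `rho_succ_sub_rho` times `2n+1+2α+R_n` telescopes, since this factor is also
`2n+1+2α+r_{n+1}+r_n`. -/
theorem rho_mul_rho_eq {α t : ℝ} (hα : 0 < α) (ht : 0 < t) (n : ℕ) :
    (n + rho α n t) * (n + rho α n t + 2 * α) =
      beta α n t * (2 * n + 1 + 2 * α + R α n t) *
        (2 * n - 1 + 2 * α + prev (fun k => R α k t) n) := by
  induction n with
  | zero => simp [beta_zero, rho]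
  | succ n ih =>
    have hA := rho_succ_sub_rho hα ht n
    simp only [prev_succ]
    rw [rho_succ] at hA ⊢
    push_cast
    linear_combination (2 * n + 1 + 2 * α + R α n t) * hA + ih

theorem sum_R_eq {α t : ℝ} (hα : 0 < α) (ht : 0 < t) (n : ℕ) :
    ∑ k ∈ Finset.range n, R α k t =
      beta α n t * ((2 * n + 1 + 2 * α + R α n t) * prev (fun k => R α k t) n +
        R α n t * (2 * n - 1 + 2 * α + prev (fun k => R α k t) n)) - rho α n t ^ 2 +
        2 * (-1) ^ n * t * (n + rho α n t) - 2 * α * t * (1 - (-1) ^ n) := by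
  induction n with
  | zero => simp [beta_zero, rho]
  | succ n ih =>
    have hA := rho_succ_sub_rho hα ht n
    have hB := beta_mul_R_sub hα ht n
    rw [Finset.sum_range_succ, ih]
    simp only [prev_succ]
    rw [rho_succ] at hA ⊢
    push_cast
    rw [pow_succ]
    linear_combination R α n t * hA - (2 * n + 1 + 2 * α + R α n t) * hB

/-! ### Derivatives with respect to the parameter -/

theorem P_zero (α t : ℝ) : P α t 0 = 1 := by
  rw [P]
  simp

theorem h_zero (α t : ℝ) : h α 0 t = negMoment α t 0 1 := by
  rw [h, P_zero, ← negMoment_zero_mul, one_mul]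

theorem R_zero (α t : ℝ) : R α 0 t = 2 * t / negMoment α t 0 1 * negMoment α t 2 1 := by
  rw [R, h_zero]
  simp [P_zero, negMoment]

theorem hasDerivAt_h_zero {α t : ℝ} (hα : 0 < α) (ht : 0 < t) :
    HasDerivAt (h α 0) (-(h α 0 t * R α 0 t) / (2 * t)) t := by
  have h0 := (h_pos hα ht.le 0).ne'
  rw [show h α 0 = fun s => negMoment α s 0 1 from funext (h_zero α)]
  refine (hasDerivAt_negMoment hα ht 0 1).congr_deriv ?_
  rw [h_zero] at h0
  rw [R_zero]
  field_simp

/-- Differentiation produces `L_4(1)`, which integration by parts with `q = 1` eliminates. -/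
theorem hasDerivAt_R_zero {α t : ℝ} (hα : 0 < α) (ht : 0 < t) :
    HasDerivAt (R α 0) ((R α 0 t * (1 + R α 0 t) - 2 * t * (1 + 2 * α + R α 0 t)) / (2 * t)) t := by
  have h0 := (h_pos hα ht.le 0).ne'
  rw [h_zero] at h0
  have hbp := byParts hα ht 1
  simp only [derivative_one, mul_zero] at hbp
  have hz : ∀ k, negMoment α t k 0 = 0 := fun k => by simp [negMoment]
  rw [hz, hz] at hbp
  rw [show R α 0 = fun s => 2 * s / negMoment α s 0 1 * negMoment α s 2 1 from
    funext (R_zero α)]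
  have d := (((hasDerivAt_id t).const_mul 2).div (hasDerivAt_negMoment hα ht 0 1) h0).mul
    (hasDerivAt_negMoment hα ht 2 1)
  refine d.congr_deriv ?_
  simp only [id, Pi.div_apply, zero_add, Nat.reduceAdd]
  field_simp
  linear_combination -negMoment α t 0 1 * hbp

/-- The `t`-derivatives of `h_n`, `β_n`, `r_n`, `β_n R_{n-1}` and `R_n` at a point `t`. -/
structure DerivFormulas (α : ℝ) (n : ℕ) (t : ℝ) : Prop where
  hasDerivAt_h : HasDerivAt (h α n) (-(h α n t * R α n t) / (2 * t)) t
  hasDerivAt_beta : HasDerivAt (beta α n)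
    (beta α n t * (prev (fun k => R α k t) n - R α n t) / (2 * t)) t
  hasDerivAt_rho : HasDerivAt (rho α n)
    (beta α n t * ((2 * n + 1 + 2 * α) * prev (fun k => R α k t) n -
      (2 * n - 1 + 2 * α) * R α n t) / (2 * t)) t
  hasDerivAt_beta_prev : HasDerivAt (fun s => beta α n s * prev (fun k => R α k s) n)
    (beta α n t * (prev (fun k => R α k t) n * (prev (fun k => R α k t) n - R α n t) +
      prev (fun k => R α k t) n * (1 - prev (fun k => R α k t) n + 2 * rho α n t) +
      2 * (-1) ^ n * t * (2 * n - 1 + 2 * α + prev (fun k => R α k t) n)) / (2 * t)) t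
  hasDerivAt_R : HasDerivAt (R α n)
    ((R α n t * (1 + R α n t - 2 * rho α n t) -
      2 * (-1) ^ n * t * (2 * n + 1 + 2 * α + R α n t)) / (2 * t)) t

/-- The difference equations hold for all `t > 0`, so they may be differentiated. The derivative of
`β_n R_{n-1}` is carried along because the formula for `R_{n+1}` involves this product, and one-step
induction has no separate derivative of `R_{n-1}`. -/
theorem derivFormulas {α : ℝ} (hα : 0 < α) (n : ℕ) :
    ∀ t : ℝ, 0 < t → DerivFormulas α n t := by
  induction n with
  | zero =>
    intro t ht
    have hb : beta α 0 = fun _ => 0 := funext fun s => beta_zero α s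
    refine ⟨hasDerivAt_h_zero hα ht, ?_, ?_, ?_, ?_⟩
    · simpa [hb] using hasDerivAt_const t (0 : ℝ)
    · simp [hb, rho]
    · simpa [hb] using hasDerivAt_const t (0 : ℝ)
    · simpa [rho] using hasDerivAt_R_zero hα ht
  | succ n ih =>
    intro t ht
    obtain ⟨dh, dβ, dρ, dE, dR⟩ := ih t ht
    have hev : ∀ᶠ s in nhds t, 0 < s := Ioi_mem_nhds ht
    have hc : (2 * n + 3 + 2 * α : ℝ) ≠ 0 := by positivity
    have hn : ∀ s, 0 < s → h α n s ≠ 0 := fun s hs => (h_pos hα hs.le n).ne'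
    have hβpos : ∀ s, 0 < s → beta α (n + 1) s ≠ 0 := fun s hs =>
      (div_pos (h_pos hα hs.le (n + 1)) (h_pos hα hs.le n)).ne'
    have hA := rho_succ_sub_rho hα ht n
    have hB := beta_mul_R_sub hα ht n
    -- Adding the two difference equations cancels `R_{n+1}` and leaves an equation linear in
    -- `β_{n+1}`.
    have hβeq : ∀ s, 0 < s → beta α (n + 1) s = (1 + R α n s - 2 * rho α n s +
        (2 * n - 1 + 2 * α) * beta α n s - 2 * (-1) ^ n * s) / (2 * n + 3 + 2 * α) := by
      intro s hs
      have hA := rho_succ_sub_rho hα hs n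
      have hB := beta_mul_R_sub hα hs n
      rw [rho_succ] at hA
      rw [eq_div_iff hc]
      linear_combination -hA - hB
    have hβt := hβeq t ht
    rw [eq_div_iff hc] at hβt
    have dβ' : HasDerivAt (beta α (n + 1))
        (beta α (n + 1) t * (R α n t - R α (n + 1) t) / (2 * t)) t := by
      have d := (((((dR.const_add 1).sub (dρ.const_mul 2)).add
        (dβ.const_mul (2 * n - 1 + 2 * α : ℝ))).sub
        ((hasDerivAt_id t).const_mul (2 * (-1) ^ n))).div_const (2 * n + 3 + 2 * α))
      refine (d.congr_deriv ?_).congr_of_eventuallyEq (hev.mono hβeq)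
      rw [rho_succ] at hA
      field_simp
      linear_combination (2 * n + 3 + 2 * α) * hB - R α n t * hβt
    have dh' : HasDerivAt (h α (n + 1)) (-(h α (n + 1) t * R α (n + 1) t) / (2 * t)) t := by
      have hmul : ∀ s, 0 < s → h α (n + 1) s = beta α (n + 1) s * h α n s := fun s hs => by
        rw [beta_succ, div_mul_cancel₀ _ (hn s hs)]
      refine ((dβ'.mul dh).congr_deriv ?_).congr_of_eventuallyEq (hev.mono hmul)
      rw [hmul t ht]
      field_simp
      ring
    have dρ' : HasDerivAt (rho α (n + 1))
        (beta α (n + 1) t * ((2 * n + 3 + 2 * α) * R α n t -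
          (2 * n + 1 + 2 * α) * R α (n + 1) t) / (2 * t)) t := by
      refine (dR.sub dρ).congr_deriv ?_
      field_simp
      linear_combination (2 * n + 1 + 2 * α) * hB - R α n t * hβt
    have dR' : HasDerivAt (R α (n + 1))
        ((R α (n + 1) t * (1 + R α (n + 1) t - 2 * rho α (n + 1) t) -
          2 * (-1) ^ (n + 1) * t * (2 * n + 3 + 2 * α + R α (n + 1) t)) / (2 * t)) t := by
      have hReq : ∀ s, 0 < s → R α (n + 1) s =
          (2 * (-1) ^ n * s + beta α n s * prev (fun k => R α k s) n) / beta α (n + 1) s := by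
        intro s hs
        rw [eq_div_iff (hβpos s hs)]
        linear_combination beta_mul_R_sub hα hs n
      have d := (((hasDerivAt_id t).const_mul (2 * (-1) ^ n)).add dE).div dβ' (hβpos t ht)
      refine (d.congr_deriv ?_).congr_of_eventuallyEq (hev.mono hReq)
      have hb := hβpos t ht
      have hE : beta α n t * prev (fun k => R α k t) n =
          beta α (n + 1) t * R α (n + 1) t - 2 * t * (-1) ^ n := by linear_combination -hB
      simp only [Pi.add_apply, id]
      rw [rho_succ] at hA ⊢
      rw [pow_succ, hE]
      field_simp
      linear_combination
        (1 - R α n t + 2 * rho α n t) * hE + 2 * t * (-1) ^ n * hA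
    refine ⟨dh', by simpa only [prev_succ] using dβ', ?_, ?_, ?_⟩
    · refine dρ'.congr_deriv ?_
      simp only [prev_succ]
      push_cast
      ring
    · refine (dβ'.mul dR).congr_deriv ?_
      simp only [prev_succ]
      rw [rho_succ, pow_succ]
      push_cast
      ring
    · refine dR'.congr_deriv ?_
      push_cast
      ring

/-! ### The logarithm of the Hankel determinant -/

theorem D_pos {α t : ℝ} (hα : 0 < α) (ht : 0 ≤ t) (n : ℕ) : 0 < D α n t := by
  rw [D_eq_prod_h hα ht]
  exact Finset.prod_pos fun k _ => h_pos hα ht k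

theorem integrand_eq {α t : ℝ} (hα : 0 < α) (ht : 0 < t) (n : ℕ) :
    integrand α n t = -(∑ k ∈ Finset.range n, R α k t) / (2 * t) := by
  have hR := R_pos hα ht n
  have hcR : (2 * n + 1 + 2 * α + R α n t : ℝ) ≠ 0 := by positivity
  have h1 := beta_mul_R_mul_prev_R hα ht n
  have h2 := rho_mul_rho_eq hα ht n
  have h3 := sum_R_eq hα ht n
  have d := (derivFormulas hα n t ht).hasDerivAt_R.deriv
  rw [integrand, d, h3]
  generalize rho α n t = r at *
  generalize beta α n t = b at *
  generalize prev (fun k => R α k t) n = Rm at *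
  generalize R α n t = R at *
  have h1' : b * Rm = -2 * (-1) ^ n * t * r / R := by
    rw [eq_div_iff hR.ne']
    linear_combination h1
  have h2' : b * (2 * n - 1 + 2 * α + Rm) =
      (n + r) * (n + r + 2 * α) / (2 * n + 1 + 2 * α + R) := by
    rw [eq_div_iff hcR]
    linear_combination -h2
  -- `β_n` and `R_{n-1}` occur only in the two combinations just solved for, so only `R_n`, `r_n`
  -- and `t` remain.
  have e : b * ((2 * n + 1 + 2 * α + R) * Rm + R * (2 * n - 1 + 2 * α + Rm)) =
      (2 * n + 1 + 2 * α + R) * (-2 * (-1) ^ n * t * r / R) +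
      R * ((n + r) * (n + r + 2 * α) / (2 * n + 1 + 2 * α + R)) := by
    rw [← h1', ← h2']
    ring
  rw [e]
  have hR0 := hR.ne'
  -- The sign `(-1)^n` cancels because it squares to `1`; the case split makes this visible to
  -- `ring`.
  rcases neg_one_pow_eq_or ℝ n with hs | hs <;>
  · rw [hs]
    field_simp
    ring

theorem hasDerivAt_neg_log_D {α t : ℝ} (hα : 0 < α) (ht : 0 < t) (n : ℕ) :
    HasDerivAt (fun s => -Real.log (D α n s)) (-integrand α n t) t := by
  have hev : ∀ᶠ s in nhds t, 0 < s := Ioi_mem_nhds ht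
  have hlog : ∀ s, 0 < s → -Real.log (D α n s) =
      -∑ k ∈ Finset.range n, Real.log (h α k s) := by
    intro s hs
    rw [D_eq_prod_h hα hs.le, Real.log_prod fun k _ => (h_pos hα hs.le k).ne']
  have d := (HasDerivAt.fun_sum (u := Finset.range n)
    (A := fun k s => Real.log (h α k s)) fun k _ =>
    (derivFormulas hα k t ht).hasDerivAt_h.log (h_pos hα ht.le k).ne').neg
  refine (d.congr_deriv ?_).congr_of_eventuallyEq (hev.mono hlog)
  rw [integrand_eq hα ht, neg_div, neg_neg, Finset.sum_div, ← Finset.sum_neg_distrib]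
  refine Finset.sum_congr rfl fun k _ => ?_
  have := (h_pos hα ht.le k).ne'
  field_simp

theorem integrand_nonpos {α t : ℝ} (hα : 0 < α) (ht : 0 < t) (n : ℕ) : integrand α n t ≤ 0 := by
  rw [integrand_eq hα ht, neg_div, neg_nonpos]
  exact div_nonneg (Finset.sum_nonneg fun k _ => (R_pos hα ht k).le) (by positivity)

theorem continuousOn_neg_log_D {α : ℝ} (hα : 0 < α) (n : ℕ) :
    ContinuousOn (fun s => -Real.log (D α n s)) (Set.Ici 0) :=
  ((continuousOn_D hα n).log fun _ hs => (D_pos hα hs n).ne').neg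

/-- A function continuous on `[0,t]` with nonnegative derivative inside has an integrable
derivative; applied to `-ln D_n`, no estimate near `0` is needed. -/
theorem intervalIntegrable_integrand {α t : ℝ} (hα : 0 < α) (ht : 0 ≤ t) (n : ℕ) :
    IntervalIntegrable (integrand α n) volume 0 t := by
  have := intervalIntegrable_deriv_of_nonneg (a := 0) (b := t)
    ((continuousOn_neg_log_D hα n).mono (by rw [Set.uIcc_of_le ht]; exact Set.Icc_subset_Ici_self))
    (fun s hs => hasDerivAt_neg_log_D hα (by simpa [ht] using hs.1) n)
    (fun s hs => neg_nonneg.2 (integrand_nonpos hα (by simpa [ht] using hs.1) n))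
  simpa [Pi.neg_def] using this.neg

end SingularJacobi

end

theorem theorem4p4 (α : ℝ) (hα : 0 < α) (n : ℕ) (t : ℝ) (ht : 0 ≤ t) :
    (∀ s : ℝ, 0 ≤ s → 0 < SingularJacobi.D α n s) ∧
    (∀ s : ℝ, 0 < s → 0 < SingularJacobi.R α n s ∧
      DifferentiableAt ℝ (SingularJacobi.R α n) s) ∧
    IntervalIntegrable (SingularJacobi.integrand α n) MeasureTheory.volume 0 t ∧
    Real.log (SingularJacobi.D α n t / SingularJacobi.D α n 0) =
      ∫ s in (0 : ℝ)..t, SingularJacobi.integrand α n s := by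
  have hint := SingularJacobi.intervalIntegrable_integrand hα ht n
  refine ⟨fun s hs => SingularJacobi.D_pos hα hs n, fun s hs => ⟨SingularJacobi.R_pos hα hs n,
    (SingularJacobi.derivFormulas hα n s hs).hasDerivAt_R.differentiableAt⟩, hint, ?_⟩
  have key := intervalIntegral.integral_eq_sub_of_hasDerivAt_of_le ht
    ((SingularJacobi.continuousOn_neg_log_D hα n).mono Set.Icc_subset_Ici_self)
    (fun s hs => SingularJacobi.hasDerivAt_neg_log_D hα hs.1 n) hint.neg
  rw [intervalIntegral.integral_neg] at key
  rw [Real.log_div (SingularJacobi.D_pos hα ht n).ne' (SingularJacobi.D_pos hα le_rfl n).ne']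
  linarith
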